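/- Corollary 3.8 ("GS gradient consistency"). For a locally Lipschitz function $f:\mathbb{R}^d\to\mathbb{R}$ let $$f^{\rm o}(x;v)=\limsup_{x'\to x,\ t\downarrow 0}\frac{f(x'+tv)-f(x')}{t},\qquad \partial_C f(x)=\{s\in\mathbb{R}^d:\ \langle s,v\rangle\le f^{\rm o}(x;v)\ \ \forall v\in\mathbb{R}^d\}$$ denote its Clarke directional derivative and its Clarke subdifferential. Call $f$ subdifferentially polynomially bounded (SPB) if it is locally Lipschitz and there exist $R_1\ge 0$, $R_2>0$ and an integer $m\ge 0$, with $R_1=0$ if and only if $m=0$, such that $\sup_{\zeta\in\partial_C f(x)}\|\zeta\|\le R_1\|x\|^m+R_2$ for all $x\in\mathbb{R}^d$ (with the convention $0^0=1$). For $\sigma>0$ let $f_\sigma(x)=\mathbb{E}_{u\sim\mathcal{N}(0,I)}[f(x+\sigma u)]$ be the Gaussian smoothing of $f$. Let $f$ be SPB and let $x\in\mathbb{R}^d$. Then for every $\sigma>0$ the expectation defining $f_\sigma(x)$ exists, and $f_\sigma$ is differentiable at $x$ with $$\nabla f_\sigma(x)=\sigma^{-1}\,\mathbb{E}_{u\sim\mathcal{N}(0,I)}[f(x+\sigma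 u)\,u],$$ where the expectation on the right-hand side exists as well. Moreover, every accumulation point of $\nabla f_\sigma(x)$ as $\sigma\to0^+$ (that is, every $\zeta\in\mathbb{R}^d$ such that $\nabla f_{\sigma_k}(x)\to\zeta$ for some sequence $\sigma_k>0$ with $\sigma_k\to0$) lies in $\partial_C f(x)$. -/

import Mathlib

open Filter Topology MeasureTheory ProbabilityTheory

noncomputable section

/-- The Clarke directional derivative
`f°(x; v) = limsup_{x' → x, t ↓ 0} (f (x' + t v) - f x') / t`.
For locally Lipschitz `f` the difference quotients are bounded near `(x, 0⁺)`, so the limsup is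
a genuine real number. -/
def clarkeDirDeriv {d : ℕ} (f : EuclideanSpace ℝ (Fin d) → ℝ)
    (x v : EuclideanSpace ℝ (Fin d)) : ℝ :=
  limsup (fun p : EuclideanSpace ℝ (Fin d) × ℝ => (f (p.1 + p.2 • v) - f p.1) / p.2)
    (𝓝 x ×ˢ 𝓝[>] (0 : ℝ))

/-- The Clarke subdifferential `∂_C f(x) = {s | ⟨s, v⟩ ≤ f°(x; v) for all v}`. -/
def clarkeSubdiff {d : ℕ} (f : EuclideanSpace ℝ (Fin d) → ℝ)
    (x : EuclideanSpace ℝ (Fin d)) : Set (EuclideanSpace ℝ (Fin d)) :=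
  {s | ∀ v, inner ℝ s v ≤ clarkeDirDeriv f x v}

/-- Subdifferentially polynomially bounded (SPB) functions: locally Lipschitz functions whose
Clarke subgradients at `x` are bounded in norm by `R₁ ‖x‖ ^ m + R₂`, where `R₁ ≥ 0`, `R₂ > 0` and
`R₁ = 0` if and only if `m = 0`. -/
def IsSPB {d : ℕ} (f : EuclideanSpace ℝ (Fin d) → ℝ) : Prop :=
  LocallyLipschitz f ∧
    ∃ (R₁ R₂ : ℝ) (m : ℕ), 0 ≤ R₁ ∧ 0 < R₂ ∧ (R₁ = 0 ↔ m = 0) ∧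
      ∀ x, ∀ ζ ∈ clarkeSubdiff f x, ‖ζ‖ ≤ R₁ * ‖x‖ ^ m + R₂

/-- The Gaussian smoothing `f_σ(x) = 𝔼_{u ∼ N(0, I)} [f (x + σ u)]`. -/
def gaussianSmoothing {d : ℕ} (f : EuclideanSpace ℝ (Fin d) → ℝ) (σ : ℝ)
    (x : EuclideanSpace ℝ (Fin d)) : ℝ :=
  ∫ u, f (x + σ • u) ∂(stdGaussian (EuclideanSpace ℝ (Fin d)))

end

/-! ### Clarke calculus: from bounds on subgradients to Lipschitz bounds. -/

section Clarke

variable {d : ℕ} {f : EuclideanSpace ℝ (Fin d) → ℝ} {x v w : EuclideanSpace ℝ (Fin d)}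

/-! By Hahn–Banach, `f°(x; ·)` is the support function of the Clarke subdifferential, so a bound on
subgradients bounds `f°`. A mean value inequality along segments turns this into a Lipschitz
constant `C * exp r` on the ball of radius `r` (`IsSPB.exists_exp_lipschitz`). Hence `f` grows at
most exponentially, and Gaussian measure integrates every `exp (c * ‖u‖)`.

Since `f` need not be differentiable, the gradient formula comes from moving the translation onto
the measure: by Cameron–Martin, `f_σ(x + σ h) = 𝔼[exp (⟨h, u⟩ - ‖h‖² / 2) f(x + σ u)]`, and only the
smooth weight depends on `h`. Differentiating at `h = 0` produces the factor `u`.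

For accumulation points, `⟨∇f_σ(x), v⟩` is a limit of averages of difference quotients of `f` at `x
+ σ u`. If `c > f°(x; v)`, these are below `c` when `σ u` is small, and elsewhere are dominated by a
multiple of `exp ‖u‖`; that region disappears as `σ → 0⁺`. So `⟨∇f_σ(x), v⟩` is eventually below any
`b > f°(x; v)`, and this passes to cluster points. -/

theorem tendsto_add_smul_prod_nhdsGT (x w : EuclideanSpace ℝ (Fin d)) :
    Tendsto (fun p : EuclideanSpace ℝ (Fin d) × ℝ => (p.1 + p.2 • w, p.2))
      (𝓝 x ×ˢ 𝓝[>] (0 : ℝ)) (𝓝 x ×ˢ 𝓝[>] (0 : ℝ)) := by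
  refine Tendsto.prodMk ?_ tendsto_snd
  have h1 : Tendsto (fun p : EuclideanSpace ℝ (Fin d) × ℝ => p.1 + p.2 • w)
      (𝓝 (x, (0 : ℝ))) (𝓝 (x + (0 : ℝ) • w)) := by
    apply Continuous.tendsto (f := fun p : EuclideanSpace ℝ (Fin d) × ℝ => p.1 + p.2 • w)
    fun_prop
  rw [zero_smul, add_zero, nhds_prod_eq] at h1
  exact h1.mono_left (prod_mono le_rfl nhdsWithin_le_nhds)

theorem eventually_snd_pos (x : EuclideanSpace ℝ (Fin d)) :
    ∀ᶠ p : EuclideanSpace ℝ (Fin d) × ℝ in 𝓝 x ×ˢ 𝓝[>] (0 : ℝ), 0 < p.2 :=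
  tendsto_snd.eventually self_mem_nhdsWithin

theorem LocallyLipschitz.eventually_abs_quotient_le (hf : LocallyLipschitz f)
    (x v : EuclideanSpace ℝ (Fin d)) :
    ∃ K : ℝ, ∀ᶠ p : EuclideanSpace ℝ (Fin d) × ℝ in 𝓝 x ×ˢ 𝓝[>] (0 : ℝ),
      |(f (p.1 + p.2 • v) - f p.1) / p.2| ≤ K := by
  obtain ⟨K, t, ht, hK⟩ := hf x
  refine ⟨K * ‖v‖, ?_⟩
  filter_upwards [eventually_snd_pos x, tendsto_fst.eventually ht,
    (tendsto_fst.comp (tendsto_add_smul_prod_nhdsGT x v)).eventually ht] with p hp h1 h2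
  have h := hK.dist_le_mul _ h2 _ h1
  simp only [Function.comp_apply, dist_eq_norm, add_sub_cancel_left, norm_smul,
    Real.norm_eq_abs, abs_of_pos hp] at h
  rw [abs_div, abs_of_pos hp, div_le_iff₀ hp]
  linarith

theorem LocallyLipschitz.clarkeDirDeriv_le (hf : LocallyLipschitz f) {b : ℝ}
    (h : ∀ᶠ p : EuclideanSpace ℝ (Fin d) × ℝ in 𝓝 x ×ˢ 𝓝[>] (0 : ℝ),
      (f (p.1 + p.2 • v) - f p.1) / p.2 ≤ b) : clarkeDirDeriv f x v ≤ b := by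
  obtain ⟨K, hK⟩ := hf.eventually_abs_quotient_le x v
  refine limsup_le_of_le ?_ h
  refine IsBoundedUnder.isCoboundedUnder_le ⟨-K, ?_⟩
  rw [eventually_map]
  exact hK.mono fun p hp => (abs_le.1 hp).1

theorem LocallyLipschitz.eventually_quotient_lt (hf : LocallyLipschitz f) {b : ℝ}
    (h : clarkeDirDeriv f x v < b) :
    ∀ᶠ p : EuclideanSpace ℝ (Fin d) × ℝ in 𝓝 x ×ˢ 𝓝[>] (0 : ℝ),
      (f (p.1 + p.2 • v) - f p.1) / p.2 < b := by
  obtain ⟨K, hK⟩ := hf.eventually_abs_quotient_le x v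
  refine eventually_lt_of_limsup_lt h ⟨K, ?_⟩
  rw [eventually_map]
  exact hK.mono fun p hp => (abs_le.1 hp).2

theorem clarkeDirDeriv_zero (f : EuclideanSpace ℝ (Fin d) → ℝ) (x : EuclideanSpace ℝ (Fin d)) :
    clarkeDirDeriv f x 0 = 0 := by
  simp [clarkeDirDeriv]

/-- Subadditivity relies on the limsup running over moving base points: the quotient along `v` is
taken from `x' + t w`, which still tends to `x`. -/
theorem LocallyLipschitz.clarkeDirDeriv_add_le (hf : LocallyLipschitz f)
    (x v w : EuclideanSpace ℝ (Fin d)) :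
    clarkeDirDeriv f x (v + w) ≤ clarkeDirDeriv f x v + clarkeDirDeriv f x w := by
  refine le_of_forall_pos_le_add fun ε hε => hf.clarkeDirDeriv_le ?_
  have h1 := (tendsto_add_smul_prod_nhdsGT x w).eventually
    (hf.eventually_quotient_lt (x := x) (v := v) (lt_add_of_pos_right _ (half_pos hε)))
  have h2 := hf.eventually_quotient_lt (x := x) (v := w) (lt_add_of_pos_right _ (half_pos hε))
  filter_upwards [h1, h2] with p h1 h2
  have h3 : p.1 + p.2 • (v + w) = p.1 + p.2 • w + p.2 • v := by module
  have h4 : (f (p.1 + p.2 • (v + w)) - f p.1) / p.2 =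
      (f (p.1 + p.2 • w + p.2 • v) - f (p.1 + p.2 • w)) / p.2
        + (f (p.1 + p.2 • w) - f p.1) / p.2 := by
    rw [h3]; ring
  rw [h4]
  linarith

theorem LocallyLipschitz.clarkeDirDeriv_smul_le (hf : LocallyLipschitz f)
    (x v : EuclideanSpace ℝ (Fin d)) {c : ℝ} (hc : 0 < c) :
    clarkeDirDeriv f x (c • v) ≤ c * clarkeDirDeriv f x v := by
  refine le_of_forall_pos_le_add fun ε hε => hf.clarkeDirDeriv_le ?_
  have ht : Tendsto (fun t : ℝ => c * t) (𝓝[>] (0 : ℝ)) (𝓝[>] (0 : ℝ)) := by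
    refine tendsto_nhdsWithin_iff.2 ⟨?_, ?_⟩
    · have : Tendsto (fun t : ℝ => c * t) (𝓝 0) (𝓝 (c * 0)) := by
        apply Continuous.tendsto; fun_prop
      rw [mul_zero] at this
      exact this.mono_left nhdsWithin_le_nhds
    · filter_upwards [self_mem_nhdsWithin] with t ht
      exact mul_pos hc ht
  have h1 := (tendsto_id.prodMap ht).eventually
    (hf.eventually_quotient_lt (x := x) (v := v) (lt_add_of_pos_right _ (div_pos hε hc)))
  filter_upwards [h1, eventually_snd_pos x] with p h1 hp
  simp only [Prod.map_fst, Prod.map_snd, id] at h1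
  have h4 : (f (p.1 + p.2 • c • v) - f p.1) / p.2 =
      c * ((f (p.1 + (c * p.2) • v) - f p.1) / (c * p.2)) := by
    rw [smul_smul, mul_comm p.2 c]; field_simp
  rw [h4]
  have := mul_le_mul_of_nonneg_left h1.le hc.le
  have h5 : c * (ε / c) = ε := by field_simp
  linarith

theorem LocallyLipschitz.clarkeDirDeriv_smul (hf : LocallyLipschitz f)
    (x v : EuclideanSpace ℝ (Fin d)) {c : ℝ} (hc : 0 < c) :
    clarkeDirDeriv f x (c • v) = c * clarkeDirDeriv f x v := by
  refine le_antisymm (hf.clarkeDirDeriv_smul_le x v hc) ?_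
  have h := hf.clarkeDirDeriv_smul_le x (c • v) (inv_pos.2 hc)
  rw [smul_smul, inv_mul_cancel₀ hc.ne', one_smul] at h
  have := mul_le_mul_of_nonneg_left h hc.le
  rwa [← mul_assoc, mul_inv_cancel₀ hc.ne', one_mul] at this

/-- The Clarke directional derivative is attained by a Clarke subgradient. -/
theorem LocallyLipschitz.exists_mem_clarkeSubdiff_inner_eq (hf : LocallyLipschitz f)
    (x : EuclideanSpace ℝ (Fin d)) (hv : v ≠ 0) :
    ∃ ζ ∈ clarkeSubdiff f x, inner ℝ ζ v = clarkeDirDeriv f x v := by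
  -- Domination on the line `ℝ v`, as Hahn–Banach requires. For `c < 0` it follows from `0 = f°(x;
  -- 0) ≤ f°(x; c v) + f°(x; -c v)`.
  have hneg : ∀ c : ℝ, c * clarkeDirDeriv f x v ≤ clarkeDirDeriv f x (c • v) := by
    intro c
    rcases lt_trichotomy c 0 with hc | rfl | hc
    · have h1 := hf.clarkeDirDeriv_add_le x (c • v) ((-c) • v)
      rw [neg_smul, add_neg_cancel, clarkeDirDeriv_zero, ← neg_smul,
        hf.clarkeDirDeriv_smul x v (neg_pos.2 hc)] at h1
      linarith
    · simp [clarkeDirDeriv_zero]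
    · exact (hf.clarkeDirDeriv_smul x v hc).ge
  obtain ⟨g, hg1, hg2⟩ := exists_extension_of_le_sublinear
    (LinearPMap.mkSpanSingleton v (clarkeDirDeriv f x v) hv) (clarkeDirDeriv f x)
    (fun c hc w => hf.clarkeDirDeriv_smul x w hc) (hf.clarkeDirDeriv_add_le x) (by
      rintro ⟨y, hy⟩
      obtain ⟨c, rfl⟩ := Submodule.mem_span_singleton.1 hy
      refine le_trans (le_of_eq ?_) (hneg c)
      exact LinearPMap.mkSpanSingleton'_apply _ _ _ c hy)
  have hv' := hg1 ⟨v, Submodule.mem_span_singleton_self v⟩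
  refine ⟨(InnerProductSpace.toDual ℝ _).symm (LinearMap.toContinuousLinearMap g), fun w => ?_, ?_⟩
  · simpa using hg2 w
  · rw [InnerProductSpace.toDual_symm_apply]
    exact hv'.trans (LinearPMap.mkSpanSingleton_apply ℝ ℝ hv _)

theorem LocallyLipschitz.clarkeDirDeriv_le_mul_norm (hf : LocallyLipschitz f) {K : ℝ}
    (hK : ∀ ζ ∈ clarkeSubdiff f x, ‖ζ‖ ≤ K) (v : EuclideanSpace ℝ (Fin d)) :
    clarkeDirDeriv f x v ≤ K * ‖v‖ := by
  rcases eq_or_ne v 0 with rfl | hv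
  · simp [clarkeDirDeriv_zero]
  · obtain ⟨ζ, hζ, h⟩ := hf.exists_mem_clarkeSubdiff_inner_eq x hv
    rw [← h]
    exact (real_inner_le_norm ζ v).trans (by gcongr; exact hK ζ hζ)

/-- A mean value inequality for the Clarke directional derivative. -/
theorem LocallyLipschitz.sub_le_of_clarkeDirDeriv_le (hf : LocallyLipschitz f) {M : ℝ}
    (h : ∀ s ∈ Set.Icc (0 : ℝ) 1, clarkeDirDeriv f (x + s • v) v ≤ M) :
    f (x + v) - f x ≤ M := by
  -- Comparison with the line of slope `M` needs only right lower Dini derivatives, so no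
  -- differentiability along the segment.
  have key := image_le_of_liminf_slope_right_le_deriv_boundary (f := fun s : ℝ => f (x + s • v))
    (a := 0) (b := 1) (B := fun s => f x + M * s) (B' := fun _ => M)
    (by have := hf.continuous; fun_prop) (by simp) (by fun_prop)
    (fun s _ => by
      simpa using (((hasDerivAt_id s).const_mul M).const_add (f x)).hasDerivWithinAt)
    (fun s hs r hr => by
      have h1 := hf.eventually_quotient_lt ((h s ⟨hs.1, hs.2.le⟩).trans_lt hr)
      -- Freezing the base point at `x + s v` leaves the one-sided quotients along the segment.
      have h2 : ∀ᶠ t in 𝓝[>] (0 : ℝ), (f (x + s • v + t • v) - f (x + s • v)) / t < r :=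
        (Tendsto.prodMk tendsto_const_nhds tendsto_id).eventually h1
      have ht : Tendsto (fun z : ℝ => z - s) (𝓝[>] s) (𝓝[>] (0 : ℝ)) := by
        refine tendsto_nhdsWithin_iff.2 ⟨?_, ?_⟩
        · have : Tendsto (fun t : ℝ => t - s) (𝓝 s) (𝓝 (s - s)) := by
            apply Continuous.tendsto; fun_prop
          rw [sub_self] at this
          exact this.mono_left nhdsWithin_le_nhds
        · filter_upwards [self_mem_nhdsWithin] with t ht
          exact sub_pos.2 (Set.mem_Ioi.1 ht)
      refine ((ht.eventually h2).mono fun z hz => ?_).frequently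
      rw [slope_def_field]
      convert! hz using 4
      module)
  have := key (Set.right_mem_Icc.2 zero_le_one)
  simp only [one_smul, mul_one] at this
  linarith

/-- Since `r ^ m ≤ m! * exp r`, the polynomial bound is traded for an exponential one: exponentials
multiply cleanly and absorb later factors such as `‖u‖`. -/
theorem IsSPB.exists_exp_lipschitz (hf : IsSPB f) :
    ∃ C : ℝ, 0 < C ∧ ∀ (r : ℝ) (y z : EuclideanSpace ℝ (Fin d)), ‖y‖ ≤ r → ‖z‖ ≤ r →
      |f y - f z| ≤ C * Real.exp r * ‖y - z‖ := by
  obtain ⟨hL, R₁, R₂, m, hR₁, hR₂, -, hb⟩ := hf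
  have hC : 0 < R₁ * m.factorial + R₂ := by positivity
  refine ⟨_, hC, ?_⟩
  have key : ∀ (r : ℝ) (y z : EuclideanSpace ℝ (Fin d)), ‖y‖ ≤ r → ‖z‖ ≤ r →
      f y - f z ≤ (R₁ * m.factorial + R₂) * Real.exp r * ‖y - z‖ := by
    intro r y z hy hz
    have hr : 0 ≤ r := (norm_nonneg y).trans hy
    have h := hL.sub_le_of_clarkeDirDeriv_le (x := z) (v := y - z)
      (M := (R₁ * m.factorial + R₂) * Real.exp r * ‖y - z‖) (fun s hs => ?_)
    · simpa using h
    · refine hL.clarkeDirDeriv_le_mul_norm (fun ζ hζ => (hb _ ζ hζ).trans ?_) _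
      have hn : ‖z + s • (y - z)‖ ≤ r := by
        have := (convex_closedBall (0 : EuclideanSpace ℝ (Fin d)) r).add_smul_sub_mem
          (mem_closedBall_zero_iff.2 hz) (mem_closedBall_zero_iff.2 hy) hs
        exact mem_closedBall_zero_iff.1 this
      have h1 : ‖z + s • (y - z)‖ ^ m ≤ m.factorial * Real.exp r := by
        have := Real.pow_div_factorial_le_exp r hr m
        rw [div_le_iff₀ (by positivity)] at this
        calc _ ≤ r ^ m := by gcongr
          _ ≤ _ := by linarith
      have h2 : 1 ≤ Real.exp r := Real.one_le_exp hr
      nlinarith [mul_le_mul_of_nonneg_left h1 hR₁]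
  intro r y z hy hz
  rw [abs_le]
  have h1 := key r y z hy hz
  have h2 := key r z y hz hy
  rw [norm_sub_rev] at h2
  constructor <;> linarith

end Clarke

/-! ### Gaussian integrability, Cameron–Martin, and differentiation of the weight. -/

section Gaussian

/-- Fernique's theorem gives an integrable `exp (C * ‖u‖ ^ 2)`; completing the square yields `c ‖u‖
≤ c² / (4C) + C ‖u‖²`. -/
theorem integrable_exp_mul_norm_stdGaussian {E : Type*} [NormedAddCommGroup E]
    [InnerProductSpace ℝ E] [FiniteDimensional ℝ E] [MeasurableSpace E] [BorelSpace E] (c : ℝ) :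
    Integrable (fun u : E => Real.exp (c * ‖u‖)) (stdGaussian E) := by
  have : CompleteSpace E := FiniteDimensional.complete ℝ E
  obtain ⟨C, hC, hint⟩ := IsGaussian.exists_integrable_exp_sq (stdGaussian E)
  refine (hint.const_mul (Real.exp (c ^ 2 / (4 * C)))).mono' (by fun_prop)
    (Eventually.of_forall fun u => ?_)
  rw [Real.norm_of_nonneg (Real.exp_pos _).le, ← Real.exp_add]
  refine Real.exp_le_exp.2 ?_
  have : c ^ 2 / (4 * C) + C * ‖u‖ ^ 2 - c * ‖u‖ = C * (‖u‖ - c / (2 * C)) ^ 2 := by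
    field_simp; ring
  nlinarith [mul_nonneg hC.le (sq_nonneg (‖u‖ - c / (2 * C)))]

variable {d : ℕ}

/-- Complex coefficients let a single formula treat the Cameron–Martin weight and the character
together, with `z i = h i + t i * I`. -/
theorem integral_cexp_sum_mul_stdGaussian (z : Fin d → ℂ) :
    ∫ u, Complex.exp (∑ i, z i * (u i : ℂ)) ∂(stdGaussian (EuclideanSpace ℝ (Fin d))) =
      Complex.exp (∑ i, z i ^ 2 / 2) := by
  rw [← map_pi_eq_stdGaussian, integral_map (by fun_prop) (by fun_prop)]
  simp_rw [Complex.exp_sum]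
  rw [integral_fintype_prod_eq_prod (f := fun i (x : ℝ) => Complex.exp (z i * (x : ℂ)))]
  refine Finset.prod_congr rfl fun i _ => ?_
  have := complexMGF_id_gaussianReal (μ := 0) (v := 1) (z i)
  simpa [complexMGF] using this

theorem integrable_exp_inner_sub_stdGaussian (h : EuclideanSpace ℝ (Fin d)) :
    Integrable (fun u => Real.exp (inner ℝ h u - ‖h‖ ^ 2 / 2))
      (stdGaussian (EuclideanSpace ℝ (Fin d))) := by
  refine (integrable_exp_mul_norm_stdGaussian ‖h‖).mono' (by fun_prop)
    (Eventually.of_forall fun u => ?_)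
  rw [Real.norm_of_nonneg (Real.exp_pos _).le]
  refine Real.exp_le_exp.2 ?_
  nlinarith [real_inner_le_norm h u, sq_nonneg ‖h‖]

/-- The Cameron–Martin formula for the standard Gaussian measure. -/
theorem stdGaussian_map_add_const (h : EuclideanSpace ℝ (Fin d)) :
    (stdGaussian (EuclideanSpace ℝ (Fin d))).map (· + h) =
      (stdGaussian (EuclideanSpace ℝ (Fin d))).withDensity
        fun u => ENNReal.ofReal (Real.exp (inner ℝ h u - ‖h‖ ^ 2 / 2)) := by
  have : IsFiniteMeasure ((stdGaussian (EuclideanSpace ℝ (Fin d))).withDensity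
      fun u => ENNReal.ofReal (Real.exp (inner ℝ h u - ‖h‖ ^ 2 / 2))) :=
    isFiniteMeasure_withDensity_ofReal (integrable_exp_inner_sub_stdGaussian h).2
  have : IsProbabilityMeasure ((stdGaussian (EuclideanSpace ℝ (Fin d))).map (· + h)) :=
    Measure.isProbabilityMeasure_map (by fun_prop)
  refine Measure.ext_of_charFun (funext fun t => ?_)
  rw [charFun_map_add_const, charFun_stdGaussian, charFun_apply,
    integral_withDensity_eq_integral_toReal_smul (by fun_prop)
      (Eventually.of_forall fun _ => ENNReal.ofReal_lt_top)]
  have h1 : ∀ u : EuclideanSpace ℝ (Fin d),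
      (ENNReal.ofReal (Real.exp (inner ℝ h u - ‖h‖ ^ 2 / 2))).toReal •
        Complex.exp (((inner ℝ u t : ℝ) : ℂ) * Complex.I) =
      Complex.exp (-(((‖h‖ ^ 2 : ℝ) : ℂ)) / 2) *
        Complex.exp (∑ i, ((h i : ℂ) + (t i : ℂ) * Complex.I) * (u i : ℂ)) := by
    intro u
    rw [ENNReal.toReal_ofReal (Real.exp_pos _).le, Complex.real_smul, Complex.ofReal_exp,
      ← Complex.exp_add, ← Complex.exp_add]
    congr 1
    have e1 : (inner ℝ h u : ℝ) = ∑ i, h i * u i := by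
      simp [PiLp.inner_apply, mul_comm]
    have e2 : (inner ℝ u t : ℝ) = ∑ i, t i * u i := by
      simp [PiLp.inner_apply]
    rw [e1, e2]
    push_cast
    simp only [add_mul, Finset.sum_add_distrib, Finset.sum_mul]
    have : ∀ i, (t i : ℂ) * (u i : ℂ) * Complex.I = (t i : ℂ) * Complex.I * (u i : ℂ) :=
      fun i => by ring
    simp only [this]
    ring
  simp_rw [h1]
  rw [integral_const_mul, integral_cexp_sum_mul_stdGaussian, ← Complex.exp_add, ← Complex.exp_add]
  congr 1
  have e1 : (inner ℝ h t : ℝ) = ∑ i, h i * t i := by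
    simp [PiLp.inner_apply, mul_comm]
  rw [← Complex.ofReal_pow, EuclideanSpace.real_norm_sq_eq, EuclideanSpace.real_norm_sq_eq, e1]
  push_cast
  have : ∀ i, ((h i : ℂ) + (t i : ℂ) * Complex.I) ^ 2 / 2 =
      (h i : ℂ) ^ 2 / 2 - (t i : ℂ) ^ 2 / 2 + (h i : ℂ) * (t i : ℂ) * Complex.I := by
    intro i
    ring_nf
    rw [Complex.I_sq]
    ring
  simp only [this, Finset.sum_add_distrib, Finset.sum_sub_distrib, ← Finset.sum_div,
    ← Finset.sum_mul]
  ring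

theorem integral_comp_add_const_stdGaussian (h : EuclideanSpace ℝ (Fin d))
    {g : EuclideanSpace ℝ (Fin d) → ℝ} (hg : Continuous g) :
    ∫ u, g (u + h) ∂(stdGaussian (EuclideanSpace ℝ (Fin d))) =
      ∫ u, Real.exp (inner ℝ h u - ‖h‖ ^ 2 / 2) * g u
        ∂(stdGaussian (EuclideanSpace ℝ (Fin d))) := by
  rw [← integral_map (φ := fun u => u + h) (f := g) (by fun_prop) hg.aestronglyMeasurable,
    stdGaussian_map_add_const, integral_withDensity_eq_integral_toReal_smul (by fun_prop)
      (Eventually.of_forall fun _ => ENNReal.ofReal_lt_top)]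
  simp_rw [ENNReal.toReal_ofReal (Real.exp_pos _).le, smul_eq_mul]

variable {g : EuclideanSpace ℝ (Fin d) → ℝ} {A B : ℝ}

theorem integrable_stdGaussian_of_le_exp (hg : Continuous g)
    (hb : ∀ u, |g u| ≤ A * Real.exp (B * ‖u‖)) :
    Integrable g (stdGaussian (EuclideanSpace ℝ (Fin d))) :=
  ((integrable_exp_mul_norm_stdGaussian B).const_mul A).mono' hg.aestronglyMeasurable
    (Eventually.of_forall hb)

theorem integrable_smul_stdGaussian_of_le_exp (hg : Continuous g)
    (hb : ∀ u, |g u| ≤ A * Real.exp (B * ‖u‖)) :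
    Integrable (fun u => g u • u) (stdGaussian (EuclideanSpace ℝ (Fin d))) := by
  have hA : 0 ≤ A := by simpa using (abs_nonneg _).trans (hb 0)
  refine ((integrable_exp_mul_norm_stdGaussian (B + 1)).const_mul A).mono'
    (Continuous.aestronglyMeasurable (by fun_prop)) (Eventually.of_forall fun u => ?_)
  rw [norm_smul, Real.norm_eq_abs, add_mul, Real.exp_add, one_mul, ← mul_assoc]
  have := Real.add_one_le_exp ‖u‖
  gcongr
  · exact hb u
  · linarith

theorem hasGradientAt_integral_exp_inner_sub (hg : Continuous g)
    (hb : ∀ u, |g u| ≤ A * Real.exp (B * ‖u‖)) :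
    HasGradientAt (fun h : EuclideanSpace ℝ (Fin d) =>
        ∫ u, Real.exp (inner ℝ h u - ‖h‖ ^ 2 / 2) * g u
          ∂(stdGaussian (EuclideanSpace ℝ (Fin d))))
      (∫ u, g u • u ∂(stdGaussian (EuclideanSpace ℝ (Fin d)))) 0 := by
  have hA : 0 ≤ A := by simpa using (abs_nonneg _).trans (hb 0)
  -- On `‖h‖ < 1` the weight and `‖u - h‖ ≤ 1 + ‖u‖` are each at most `exp ‖u‖`, hence the exponent
  -- `B + 2`.
  have key := hasFDerivAt_integral_of_dominated_of_fderiv_le (𝕜 := ℝ)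
    (μ := stdGaussian (EuclideanSpace ℝ (Fin d)))
    (F := fun (h u : EuclideanSpace ℝ (Fin d)) => Real.exp (inner ℝ h u - ‖h‖ ^ 2 / 2) * g u)
    (F' := fun h u => g u • Real.exp (inner ℝ h u - ‖h‖ ^ 2 / 2) • innerSL ℝ (u - h))
    (bound := fun u => A * Real.exp ((B + 2) * ‖u‖))
    (x₀ := 0) (Metric.ball_mem_nhds 0 one_pos)
    (Eventually.of_forall fun h => Continuous.aestronglyMeasurable (by fun_prop))
    (by simpa using integrable_stdGaussian_of_le_exp hg hb)
    (Continuous.aestronglyMeasurable (by fun_prop))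
    (Eventually.of_forall fun u h hh => ?_)
    ((integrable_exp_mul_norm_stdGaussian (B + 2)).const_mul A)
    (Eventually.of_forall fun u h _ => ?_)
  · rw [hasGradientAt_iff_hasFDerivAt]
    convert! key using 1
    simp only [inner_zero_left, norm_zero, sub_zero, ne_eq, OfNat.ofNat_ne_zero, not_false_eq_true,
      zero_pow, zero_div, Real.exp_zero, one_smul]
    have e := (innerSL ℝ).integral_comp_comm (integrable_smul_stdGaussian_of_le_exp hg hb)
    simp only [map_smul] at e
    exact e.symm
  · have hh : ‖h‖ < 1 := mem_ball_zero_iff.1 hh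
    rw [norm_smul, norm_smul, innerSL_apply_norm, Real.norm_eq_abs,
      Real.norm_of_nonneg (Real.exp_pos _).le]
    have h1 : Real.exp (inner ℝ h u - ‖h‖ ^ 2 / 2) ≤ Real.exp ‖u‖ := by
      refine Real.exp_le_exp.2 ?_
      nlinarith [real_inner_le_norm h u, sq_nonneg ‖h‖, norm_nonneg u]
    have h2 : ‖u - h‖ ≤ Real.exp ‖u‖ := by
      have := Real.add_one_le_exp ‖u‖
      have := norm_sub_le u h
      linarith
    calc |g u| * (Real.exp (inner ℝ h u - ‖h‖ ^ 2 / 2) * ‖u - h‖)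
        ≤ (A * Real.exp (B * ‖u‖)) * (Real.exp ‖u‖ * Real.exp ‖u‖) := by
          gcongr
          exact hb u
      _ = A * Real.exp ((B + 2) * ‖u‖) := by
          rw [mul_assoc, ← Real.exp_add, ← Real.exp_add]
          ring_nf
  · have h1 : HasFDerivAt (fun h : EuclideanSpace ℝ (Fin d) => inner ℝ h u - ‖h‖ ^ 2 / 2)
        (innerSL ℝ (u - h)) h := by
      have e1 : HasFDerivAt (fun h : EuclideanSpace ℝ (Fin d) => inner ℝ u h) (innerSL ℝ u) h :=
        (innerSL ℝ u).hasFDerivAt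
      have e2 := ((hasStrictFDerivAt_norm_sq h).hasFDerivAt.const_mul (1 / 2 : ℝ))
      convert! e1.sub e2 using 1
      · ext y
        simp [real_inner_comm]
        ring
      · ext y
        simp
    have h2 := h1.exp.mul_const (g u)
    exact h2

theorem hasGradientAt_gaussianSmoothing {f : EuclideanSpace ℝ (Fin d) → ℝ}
    {x : EuclideanSpace ℝ (Fin d)} {σ : ℝ} (hf : Continuous f) (hσ : 0 < σ)
    (hb : ∀ u, |f (x + σ • u)| ≤ A * Real.exp (B * ‖u‖)) :
    HasGradientAt (gaussianSmoothing f σ)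
      (σ⁻¹ • ∫ u, f (x + σ • u) • u ∂(stdGaussian (EuclideanSpace ℝ (Fin d)))) x := by
  have hc : Continuous fun u => f (x + σ • u) := by fun_prop
  have h1 := (hasGradientAt_integral_exp_inner_sub hc hb).hasFDerivAt
  have h2 : HasFDerivAt (fun y : EuclideanSpace ℝ (Fin d) => σ⁻¹ • (y - x))
      (σ⁻¹ • ContinuousLinearMap.id ℝ _) x := ((hasFDerivAt_id x).sub_const x).const_smul σ⁻¹
  -- Substituting `h = σ⁻¹ (y - x)` sends `y = x` to `0`; the chain rule supplies the factor `σ⁻¹`.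
  rw [show (0 : EuclideanSpace ℝ (Fin d)) = σ⁻¹ • (x - x) by simp] at h1
  have h3 := h1.comp x h2
  rw [hasGradientAt_iff_hasFDerivAt]
  convert! h3 using 1
  · funext y
    simp only [gaussianSmoothing, Function.comp_apply]
    rw [← integral_comp_add_const_stdGaussian _ hc]
    congr with u
    rw [smul_add, smul_smul, mul_inv_cancel₀ hσ.ne', one_smul]
    congr 1
    abel
  · ext y
    simp

end Gaussian

/-! ### Smoothing of SPB functions and the limit `σ → 0⁺`. -/

section Smoothing

variable {d : ℕ} {f : EuclideanSpace ℝ (Fin d) → ℝ}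

/-- Comparison with `f 0`. The exponent doubles because one exponential is the Lipschitz constant
and another absorbs the distance `‖x + σ u‖`. -/
theorem IsSPB.exists_abs_le_exp (hf : IsSPB f) (x : EuclideanSpace ℝ (Fin d)) :
    ∃ A : ℝ, ∀ σ : ℝ, 0 ≤ σ → ∀ u : EuclideanSpace ℝ (Fin d),
      |f (x + σ • u)| ≤ A * Real.exp (2 * σ * ‖u‖) := by
  obtain ⟨C, hC, h⟩ := hf.exists_exp_lipschitz
  refine ⟨(|f 0| + C) * Real.exp (2 * ‖x‖), fun σ hσ u => ?_⟩
  have hr : ‖x + σ • u‖ ≤ ‖x‖ + σ * ‖u‖ := by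
    simpa [norm_smul, abs_of_nonneg hσ] using norm_add_le x (σ • u)
  have h0 : 0 ≤ ‖x‖ + σ * ‖u‖ := by positivity
  have h1 := h _ _ 0 hr (by simpa using h0)
  rw [sub_zero] at h1
  have h2 := abs_sub_abs_le_abs_sub (f (x + σ • u)) (f 0)
  have h3 := Real.add_one_le_exp (‖x‖ + σ * ‖u‖)
  have h4 : C * Real.exp (‖x‖ + σ * ‖u‖) * ‖x + σ • u‖ ≤
      C * (Real.exp (‖x‖ + σ * ‖u‖) * Real.exp (‖x‖ + σ * ‖u‖)) := by
    rw [mul_assoc]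
    gcongr
    linarith
  have h5 : Real.exp (2 * ‖x‖) * Real.exp (2 * σ * ‖u‖) =
      Real.exp (‖x‖ + σ * ‖u‖) * Real.exp (‖x‖ + σ * ‖u‖) := by
    rw [← Real.exp_add, ← Real.exp_add]; ring_nf
  have h6 : 1 ≤ Real.exp (‖x‖ + σ * ‖u‖) := Real.one_le_exp h0
  rw [mul_assoc, h5]
  nlinarith [abs_nonneg (f 0), mul_le_mul h6 h6 zero_le_one (by positivity)]

theorem IsSPB.integrable_comp_stdGaussian (hf : IsSPB f) (x : EuclideanSpace ℝ (Fin d)) {σ : ℝ}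
    (hσ : 0 < σ) :
    Integrable (fun u => f (x + σ • u)) (stdGaussian (EuclideanSpace ℝ (Fin d))) := by
  obtain ⟨A, hA⟩ := hf.exists_abs_le_exp x
  have := hf.1.continuous
  exact integrable_stdGaussian_of_le_exp (by fun_prop) (hA σ hσ.le)

theorem IsSPB.integrable_comp_smul_stdGaussian (hf : IsSPB f) (x : EuclideanSpace ℝ (Fin d))
    {σ : ℝ} (hσ : 0 < σ) :
    Integrable (fun u => f (x + σ • u) • u) (stdGaussian (EuclideanSpace ℝ (Fin d))) := by
  obtain ⟨A, hA⟩ := hf.exists_abs_le_exp x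
  have := hf.1.continuous
  exact integrable_smul_stdGaussian_of_le_exp (g := fun u => f (x + σ • u)) (by fun_prop)
    (hA σ hσ.le)

theorem IsSPB.hasGradientAt_gaussianSmoothing (hf : IsSPB f) (x : EuclideanSpace ℝ (Fin d))
    {σ : ℝ} (hσ : 0 < σ) :
    HasGradientAt (gaussianSmoothing f σ)
      (σ⁻¹ • ∫ u, f (x + σ • u) • u ∂(stdGaussian (EuclideanSpace ℝ (Fin d)))) x := by
  obtain ⟨A, hA⟩ := hf.exists_abs_le_exp x
  exact _root_.hasGradientAt_gaussianSmoothing hf.1.continuous hσ (hA σ hσ.le)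

theorem IsSPB.inner_gradient_gaussianSmoothing_le (hf : IsSPB f)
    {x v : EuclideanSpace ℝ (Fin d)} {σ δ : ℝ} (hσ : 0 < σ) (hδ : 0 < δ)
    {G : EuclideanSpace ℝ (Fin d) → ℝ}
    (hG : Integrable G (stdGaussian (EuclideanSpace ℝ (Fin d))))
    (hle : ∀ t ∈ Set.Ioo 0 δ, ∀ u, (f (x + σ • u + t • v) - f (x + σ • u)) / t ≤ G u) :
    inner ℝ (gradient (gaussianSmoothing f σ) x) v ≤
      ∫ u, G u ∂(stdGaussian (EuclideanSpace ℝ (Fin d))) := by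
  have h := (hf.hasGradientAt_gaussianSmoothing x hσ).differentiableAt.hasGradientAt
  have hs := (h.hasFDerivAt.hasLineDerivAt v).tendsto_slope_zero_right
  rw [InnerProductSpace.toDual_apply_apply] at hs
  refine le_of_tendsto hs ?_
  filter_upwards [Ioo_mem_nhdsGT hδ] with t ht
  have e : t⁻¹ • (gaussianSmoothing f σ (x + t • v) - gaussianSmoothing f σ x) =
      ∫ u, (f (x + σ • u + t • v) - f (x + σ • u)) / t
        ∂(stdGaussian (EuclideanSpace ℝ (Fin d))) := by
    have e1 : ∀ u, x + σ • u + t • v = x + t • v + σ • u := fun u => by abel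
    simp_rw [e1]
    rw [integral_div, integral_sub (hf.integrable_comp_stdGaussian _ hσ)
      (hf.integrable_comp_stdGaussian _ hσ), smul_eq_mul, inv_mul_eq_div]
    rfl
  rw [e]
  refine integral_mono ?_ hG (hle t ht)
  have e1 : ∀ u, x + σ • u + t • v = x + t • v + σ • u := fun u => by abel
  simp_rw [e1]
  exact ((hf.integrable_comp_stdGaussian _ hσ).sub
    (hf.integrable_comp_stdGaussian _ hσ)).div_const t

/-- The function serves as majorant of the difference quotients: `b` where `x + σ u` is within `δ`
of `x`, the global Lipschitz estimate elsewhere. -/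
theorem integrable_ite_mul_norm_lt_stdGaussian (b M δ σ : ℝ) :
    Integrable (fun u => if σ * ‖u‖ < δ then b else M * Real.exp ‖u‖)
      (stdGaussian (EuclideanSpace ℝ (Fin d))) := by
  have h := (integrable_exp_mul_norm_stdGaussian (E := EuclideanSpace ℝ (Fin d)) 1).const_mul M
  simp only [one_mul] at h
  exact Integrable.piecewise (s := {u : EuclideanSpace ℝ (Fin d) | σ * ‖u‖ < δ})
    (measurableSet_lt (by fun_prop) (by fun_prop)) (integrable_const b).integrableOn
    h.integrableOn

theorem tendsto_integral_ite_mul_norm_lt_stdGaussian (b M : ℝ) {δ : ℝ} (hδ : 0 < δ) :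
    Tendsto (fun σ : ℝ => ∫ u, (if σ * ‖u‖ < δ then b else M * Real.exp ‖u‖)
      ∂(stdGaussian (EuclideanSpace ℝ (Fin d)))) (𝓝[>] 0) (𝓝 b) := by
  have h := (integrable_exp_mul_norm_stdGaussian (E := EuclideanSpace ℝ (Fin d)) 1).const_mul |M|
  simp only [one_mul] at h
  have hb : b = ∫ _, b ∂(stdGaussian (EuclideanSpace ℝ (Fin d))) := by simp
  conv => rhs; rw [hb]
  refine tendsto_integral_filter_of_dominated_convergence
    (fun u => |b| + |M| * Real.exp ‖u‖)
    (Eventually.of_forall fun σ => (integrable_ite_mul_norm_lt_stdGaussian b M δ σ).1)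
    (Eventually.of_forall fun σ => Eventually.of_forall fun u => ?_)
    ((integrable_const _).add h)
    (Eventually.of_forall fun u => ?_)
  · split_ifs
    · rw [Real.norm_eq_abs]
      exact le_add_of_nonneg_right (by positivity)
    · rw [norm_mul, Real.norm_eq_abs, Real.norm_of_nonneg (Real.exp_pos _).le]
      exact le_add_of_nonneg_left (by positivity)
  · have : Tendsto (fun σ : ℝ => σ * ‖u‖) (𝓝[>] 0) (𝓝 (0 * ‖u‖)) :=
      (Continuous.tendsto (by fun_prop) 0).mono_left nhdsWithin_le_nhds
    rw [zero_mul] at this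
    refine tendsto_const_nhds.congr' ?_
    filter_upwards [this.eventually_lt_const hδ] with σ hσ
    rw [if_pos hσ]

theorem IsSPB.eventually_inner_gradient_lt (hf : IsSPB f) {x v : EuclideanSpace ℝ (Fin d)} {b : ℝ}
    (hb : clarkeDirDeriv f x v < b) :
    ∀ᶠ σ in 𝓝[>] (0 : ℝ), inner ℝ (gradient (gaussianSmoothing f σ) x) v < b := by
  -- `c` bounds the quotients near `x`; the gap `c < b` absorbs the tail of the integral for small
  -- `σ`.
  obtain ⟨c, hc, hcb⟩ := exists_between hb
  obtain ⟨C, hC, hlip⟩ := hf.exists_exp_lipschitz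
  obtain ⟨p, hp, q, hq, hpq⟩ := eventually_prod_iff.1 (hf.1.eventually_quotient_lt hc)
  obtain ⟨δ, hδ, hpδ⟩ := Metric.eventually_nhds_iff.1 hp
  obtain ⟨τ, hτ, hqτ⟩ := mem_nhdsGT_iff_exists_Ioo_subset.1 hq
  have hτ : 0 < τ := hτ
  have hlim := tendsto_integral_ite_mul_norm_lt_stdGaussian (d := d) c
    (C * Real.exp (‖x‖ + ‖v‖) * ‖v‖) hδ
  filter_upwards [hlim.eventually_lt_const hcb, Ioo_mem_nhdsGT one_pos] with σ hσ hσ1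
  -- `t < τ` serves the local bound; `t < 1` and `σ < 1` keep both points in the ball of radius `‖x‖
  -- + ‖v‖ + ‖u‖`, so the tail bound is independent of `σ` and `t`.
  refine lt_of_le_of_lt (hf.inner_gradient_gaussianSmoothing_le hσ1.1 (lt_min hτ one_pos)
    (integrable_ite_mul_norm_lt_stdGaussian _ _ _ _) fun t ht u => ?_) hσ
  have ht1 : t < 1 := ht.2.trans_le (min_le_right _ _)
  have hu : ‖σ • u‖ = σ * ‖u‖ := by rw [norm_smul, Real.norm_of_nonneg hσ1.1.le]
  have htv : ‖t • v‖ = t * ‖v‖ := by rw [norm_smul, Real.norm_of_nonneg ht.1.le]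
  split_ifs with hlt
  · refine (hpq (hpδ ?_) (hqτ ⟨ht.1, ht.2.trans_le (min_le_left _ _)⟩)).le
    rwa [dist_eq_norm, add_sub_cancel_left, hu]
  · have hu1 : ‖σ • u‖ ≤ ‖u‖ := by
      rw [hu]; exact mul_le_of_le_one_left (norm_nonneg _) hσ1.2.le
    have hv1 : ‖t • v‖ ≤ ‖v‖ := by
      rw [htv]; exact mul_le_of_le_one_left (norm_nonneg _) ht1.le
    have n1 := norm_add_le x (σ • u)
    have n2 := norm_add_le (x + σ • u) (t • v)
    have h := hlip (‖x‖ + ‖v‖ + ‖u‖) (x + σ • u + t • v) (x + σ • u) (by linarith)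
      (by linarith [norm_nonneg v])
    rw [add_sub_cancel_left, htv, Real.exp_add _ ‖u‖] at h
    rw [div_le_iff₀ ht.1]
    linarith [le_abs_self (f (x + σ • u + t • v) - f (x + σ • u))]

theorem IsSPB.mem_clarkeSubdiff_of_mapClusterPt (hf : IsSPB f) {x ζ : EuclideanSpace ℝ (Fin d)}
    (hζ : MapClusterPt ζ (𝓝[>] (0 : ℝ)) fun σ : ℝ => gradient (gaussianSmoothing f σ) x) :
    ζ ∈ clarkeSubdiff f x := by
  intro v
  by_contra! hlt
  obtain ⟨b, hb, hbζ⟩ := exists_between hlt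
  have hopen : ∀ᶠ s in 𝓝 ζ, b < inner ℝ s v :=
    (Continuous.tendsto (f := fun s => inner ℝ s v) (by fun_prop) ζ).eventually_const_lt hbζ
  obtain ⟨σ, h1, h2⟩ := ((hζ.frequently hopen).and_eventually
    (hf.eventually_inner_gradient_lt hb)).exists
  exact lt_asymm h1 h2

end Smoothing

/-- The Gaussian smoothings of an SPB function `f` are well defined and differentiable, with
`∇f_σ(x) = σ⁻¹ 𝔼[f (x + σ u) u]`, and every accumulation point of `∇f_σ(x)` as `σ → 0⁺` belongs to
the Clarke subdifferential of `f` at `x`. -/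
theorem corollary3p8 (d : ℕ) (f : EuclideanSpace ℝ (Fin d) → ℝ) (hf : IsSPB f)
    (x : EuclideanSpace ℝ (Fin d)) :
    (∀ σ : ℝ, 0 < σ →
      Integrable (fun u => f (x + σ • u)) (stdGaussian (EuclideanSpace ℝ (Fin d))) ∧
      Integrable (fun u => f (x + σ • u) • u) (stdGaussian (EuclideanSpace ℝ (Fin d))) ∧
      HasGradientAt (gaussianSmoothing f σ)
        (σ⁻¹ • ∫ u, f (x + σ • u) • u ∂(stdGaussian (EuclideanSpace ℝ (Fin d)))) x) ∧
    ∀ ζ : EuclideanSpace ℝ (Fin d),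
      MapClusterPt ζ (𝓝[>] (0 : ℝ)) (fun σ : ℝ => gradient (gaussianSmoothing f σ) x) →
        ζ ∈ clarkeSubdiff f x :=
  ⟨fun _ hσ => ⟨hf.integrable_comp_stdGaussian x hσ, hf.integrable_comp_smul_stdGaussian x hσ,
    hf.hasGradientAt_gaussianSmoothing x hσ⟩, fun _ hζ => hf.mem_clarkeSubdiff_of_mapClusterPt hζ⟩
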